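/- **Theorem 1.1.** Let $u_0:(0,\infty)\to\mathbb R$ (of any sign) satisfy $\int_0^\infty |u_0(x)|\,(1+x+x^2)\,dx<\infty$, and let $u$ be the solution of the heat equation on the half line $$u_t=u_{xx}\quad (x>0,\ t>0),\qquad u(0,t)=0\quad (t>0),\qquad u(x,0)=u_0(x)\quad (x>0),$$ that is, the solution $u\in C([0,\infty);L^1(\mathbb R_+))$, with $u(\cdot,0)=u_0$ almost everywhere, which is $C^{2,1}$ (in $x$ and $t$) in $\{x>0,\ t>0\}$ and continuous in $\{x\ge 0,\ t>0\}$. Set $$M_1^*=\int_0^\infty u_0(x)\,x\,dx,\qquad \Gamma(x,t)=\frac{1}{\sqrt{4\pi t}}\,e^{-x^2/(4t)},\qquad D(x,t)=\Gamma_x(x,t).$$ Then $$\frac{t^{3/2}}{x+1}\,\bigl|u(x,t)+2M_1^*D(x,t)\bigr|\to 0\quad\text{as } t\to\infty,\ \text{uniformly in } x\in[0,\infty).$$ -/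

import Mathlib

open Set Filter Topology MeasureTheory

noncomputable section

/-- The fundamental solution `Γ(x,t) = (4πt)^{-1/2} exp(-x²/(4t))` of the heat equation
`u_t = u_xx` on the real line (meaningful for `t > 0`). -/
def heatKernel (x t : ℝ) : ℝ :=
  (Real.sqrt (4 * Real.pi * t))⁻¹ * Real.exp (-x ^ 2 / (4 * t))

/-- The dipole solution `D = Γ_x`. -/
def dipole (x t : ℝ) : ℝ := deriv (fun y => heatKernel y t) x

/-- The first momentum `∫₀^∞ f(x) x dx` of a function on the half line. -/
def firstMoment (f : ℝ → ℝ) : ℝ := ∫ x in Ioi (0 : ℝ), f x * x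

/-- `u = u(x,t)` is a solution of the heat equation on the half line,
`u_t = u_xx` for `x > 0`, `t > 0`, with `u(0,t) = 0` for `t > 0` and `u(x,0) = u₀(x)`:
a classical (`C^{2,1}`) solution in the open quarter plane, continuous up to the lateral
boundary, which belongs to `C([0,∞); L¹(ℝ₊))` and takes the initial value `u₀` there.
Only the values `u x t` with `0 ≤ x`, `0 ≤ t` matter. -/
structure IsDirichletHeatSolution (u₀ : ℝ → ℝ) (u : ℝ → ℝ → ℝ) : Prop where
  /-- `u` is continuous on `[0,∞) × (0,∞)`. -/
  continuousOn : ContinuousOn (fun p : ℝ × ℝ => u p.1 p.2) (Ici 0 ×ˢ Ioi 0)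
  /-- `u_t` exists. -/
  differentiableAt_time : ∀ x > 0, ∀ t > 0, DifferentiableAt ℝ (fun s => u x s) t
  /-- `u_x` exists. -/
  differentiableAt_space : ∀ x > 0, ∀ t > 0, DifferentiableAt ℝ (fun y => u y t) x
  /-- `u_xx` exists. -/
  differentiableAt_deriv_space : ∀ x > 0, ∀ t > 0,
    DifferentiableAt ℝ (deriv (fun y => u y t)) x
  /-- `u_t` is continuous. -/
  continuousOn_time : ContinuousOn
    (fun p : ℝ × ℝ => deriv (fun s => u p.1 s) p.2) (Ioi 0 ×ˢ Ioi 0)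
  /-- `u_x` is continuous. -/
  continuousOn_space : ContinuousOn
    (fun p : ℝ × ℝ => deriv (fun y => u y p.2) p.1) (Ioi 0 ×ˢ Ioi 0)
  /-- `u_xx` is continuous. -/
  continuousOn_space_space : ContinuousOn
    (fun p : ℝ × ℝ => deriv (deriv (fun y => u y p.2)) p.1) (Ioi 0 ×ˢ Ioi 0)
  /-- The equation `u_t = u_xx`. -/
  equation : ∀ x > 0, ∀ t > 0,
    deriv (fun s => u x s) t = deriv (deriv (fun y => u y t)) x
  /-- The Dirichlet condition. -/
  boundary : ∀ t > 0, u 0 t = 0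
  /-- `u(·,t) ∈ L¹(ℝ₊)` for every `t ≥ 0`. -/
  integrable : ∀ t ≥ 0, IntegrableOn (fun x => u x t) (Ioi 0)
  /-- `t ↦ u(·,t)` is continuous from `[0,∞)` to `L¹(ℝ₊)`. -/
  continuous_L1 : ∀ t₀ ≥ 0,
    Tendsto (fun t => ∫ x in Ioi (0 : ℝ), |u x t - u x t₀|) (𝓝[Ici 0] t₀) (𝓝 0)
  /-- The initial condition. -/
  initial : ∀ᵐ x ∂(volume.restrict (Ioi (0 : ℝ))), u x 0 = u₀ x

end

/-!
The solution is given by the Dirichlet kernel `G(x,y,t) = Γ(x-y,t) - Γ(x+y,t)` of the half line.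
The kernel is odd in `y`, its linear part at `y = 0` is `-2yD(x,t)`, and its second derivative in
`y`, namely `Γ_xx(x-y,t) - Γ_xx(x+y,t)`, is `O(x t⁻²)` by the Lipschitz bound for `Γ_xx`. Hence
`|G(x,y,t) + 2yD(x,t)| ≤ 3xy²/t²` (`abs_dirichletKernel_add_dipole_le`), and integration against `u₀`
gives `|u + 2M₁*D| ≤ C x t⁻²` with `C` controlled by the weighted norm of `u₀`
(`IsDirichletHeatSolution.abs_add_dipole_le`). After multiplication by `t^{3/2}/(x+1)` a factor
`t^{-1/2}` remains, uniformly in `x`.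

What has to be justified is the representation of an arbitrary solution, which is a uniqueness
statement: `u_x` may be singular at the lateral boundary, and at infinity only `u(·,t) ∈ L¹` is
known. The proof is by duality. If `φ` solves the backward equation with `φ(0,s) = 0` and `φ`,
`φ_y` bounded, then `∫ u φ` does not depend on time: Green's identity on a rectangle
(`IsDirichletHeatSolution.green_identity`), applied to `φ` times a cutoff, leaves only commutator
terms supported where the cutoff varies. Because `φ` vanishes linearly at `0`, these terms are
bounded by the supremum of `u` near the boundary and by `‖u‖_{L¹}/R` near infinity, and both tend
to zero (`IsDirichletHeatSolution.pairing_eq`). With `φ(y,s) = G(x,y,T+δ-s)` and `s → 0` this reads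
`∫ u(y,T) G(x,y,δ) dy = ∫ u₀(y) G(x,y,T+δ) dy`
(`IsDirichletHeatSolution.integral_mul_dirichletKernel_eq`). The kernel estimate is applied to the
right-hand side at time `T+δ`; as `δ → 0` the left-hand side tends to `u(x,T)` because the kernel
is an approximate identity.
-/

/-! ### The Gauss kernel -/

lemma hasDerivAt_heatKernel_space {t : ℝ} (ht : 0 < t) (x : ℝ) :
    HasDerivAt (fun y => heatKernel y t) (-(x / (2 * t)) * heatKernel x t) x := by
  have h : HasDerivAt (fun y : ℝ => -y ^ 2 / (4 * t)) (-(x / (2 * t))) x := by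
    convert! ((hasDerivAt_pow 2 x).neg.div_const (4 * t)) using 1
    field_simp
    norm_num [mul_comm]
  convert! h.exp.const_mul ((Real.sqrt (4 * Real.pi * t))⁻¹) using 1
  simp only [heatKernel]; ring

lemma dipole_eq {t : ℝ} (ht : 0 < t) (x : ℝ) :
    dipole x t = -(x / (2 * t)) * heatKernel x t :=
  (hasDerivAt_heatKernel_space ht x).deriv

/-- The second space derivative `Γ_xx` of the Gauss kernel, which is also `Γ_t`. -/
noncomputable def heatKernelXX (x t : ℝ) : ℝ :=
  (x ^ 2 / (4 * t ^ 2) - 1 / (2 * t)) * heatKernel x t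

lemma hasDerivAt_dipole {t : ℝ} (ht : 0 < t) (x : ℝ) :
    HasDerivAt (fun y => dipole y t) (heatKernelXX x t) x := by
  have h : (fun y => dipole y t) = fun y => -(y / (2 * t)) * heatKernel y t :=
    funext fun y => dipole_eq ht y
  rw [h]
  have := (((hasDerivAt_id x).div_const (2 * t)).neg).mul (hasDerivAt_heatKernel_space ht x)
  convert! this using 1
  simp only [heatKernelXX, id]
  field_simp
  simp only [Pi.neg_apply]
  field_simp
  ring

lemma hasDerivAt_heatKernel_time {t : ℝ} (ht : 0 < t) (x : ℝ) :
    HasDerivAt (fun s => heatKernel x s) (heatKernelXX x t) t := by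
  have hp : 0 < 4 * Real.pi * t := by positivity
  have h1 : HasDerivAt (fun s : ℝ => (Real.sqrt (4 * Real.pi * s))⁻¹)
      (-(1 / (2 * t)) * (Real.sqrt (4 * Real.pi * t))⁻¹) t := by
    have h := (((hasDerivAt_id t).const_mul (4 * Real.pi)).sqrt hp.ne').inv
      (Real.sqrt_pos.2 hp).ne'
    convert! h using 1
    have hs : Real.sqrt (4 * Real.pi * t) ^ 2 = 4 * Real.pi * t := Real.sq_sqrt hp.le
    have hs0 := (Real.sqrt_pos.2 hp).ne'
    simp only [id]
    rw [hs]
    field_simp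
  have h2 : HasDerivAt (fun s : ℝ => -x ^ 2 / (4 * s)) (x ^ 2 / (4 * t ^ 2)) t := by
    have h := ((hasDerivAt_id t).const_mul 4).fun_inv (by simp [ht.ne']) |>.const_mul (-x ^ 2)
    simp only [← div_eq_mul_inv, id] at h
    convert! h using 1
    field_simp
  convert! h1.mul h2.exp using 1
  simp only [heatKernelXX, heatKernel]; ring

lemma continuousOn_heatKernel :
    ContinuousOn (fun p : ℝ × ℝ => heatKernel p.1 p.2) (univ ×ˢ Ioi 0) := by
  intro p hp
  have hp : 0 < p.2 := hp.2
  unfold heatKernel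
  refine ContinuousAt.continuousWithinAt ?_
  have h0 : Real.sqrt (4 * Real.pi * p.2) ≠ 0 := (Real.sqrt_pos.2 (by positivity)).ne'
  have h1 : 4 * p.2 ≠ 0 := by positivity
  fun_prop (disch := assumption)

lemma continuousOn_dipole :
    ContinuousOn (fun p : ℝ × ℝ => dipole p.1 p.2) (univ ×ˢ Ioi 0) := by
  have : ContinuousOn (fun p : ℝ × ℝ => -(p.1 / (2 * p.2)) * heatKernel p.1 p.2)
      (univ ×ˢ Ioi 0) := by
    refine ContinuousOn.mul ?_ continuousOn_heatKernel
    refine (continuousOn_fst.div (by fun_prop) fun p hp => ?_).neg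
    have : 0 < p.2 := hp.2
    positivity
  exact this.congr fun p hp => dipole_eq hp.2 p.1

lemma continuousOn_heatKernelXX :
    ContinuousOn (fun p : ℝ × ℝ => heatKernelXX p.1 p.2) (univ ×ˢ Ioi 0) := by
  refine ContinuousOn.mul (ContinuousOn.sub ?_ ?_) continuousOn_heatKernel
  · refine ContinuousOn.div (by fun_prop) (by fun_prop) fun p hp => ?_
    have : 0 < p.2 := hp.2
    positivity
  · refine ContinuousOn.div (by fun_prop) (by fun_prop) fun p hp => ?_
    have : 0 < p.2 := hp.2
    positivity

lemma heatKernel_neg (x t : ℝ) : heatKernel (-x) t = heatKernel x t := by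
  simp [heatKernel]

lemma heatKernel_nonneg (x t : ℝ) : 0 ≤ heatKernel x t := by
  unfold heatKernel; positivity

lemma heatKernel_le {δ t : ℝ} (hδ : 0 < δ) (h : δ ≤ t) (x : ℝ) :
    heatKernel x t ≤ (Real.sqrt (4 * Real.pi * δ))⁻¹ := by
  have ht : 0 < t := hδ.trans_le h
  have h1 : Real.exp (-x ^ 2 / (4 * t)) ≤ 1 := by
    rw [Real.exp_le_one_iff, neg_div]
    have : 0 ≤ x ^ 2 / (4 * t) := by positivity
    linarith
  have h2 : (Real.sqrt (4 * Real.pi * t))⁻¹ ≤ (Real.sqrt (4 * Real.pi * δ))⁻¹ := by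
    gcongr
  unfold heatKernel
  calc _ ≤ (Real.sqrt (4 * Real.pi * t))⁻¹ * 1 := by gcongr
    _ ≤ _ := by simpa using h2

lemma abs_dipole_le {δ t : ℝ} (hδ : 0 < δ) (h : δ ≤ t) (x : ℝ) :
    |dipole x t| ≤ (1 + 1 / δ) * (Real.sqrt (4 * Real.pi * δ))⁻¹ := by
  have ht : 0 < t := hδ.trans_le h
  -- `|x| e^{-x²/(4t)} ≤ t + 1` because `|x| ≤ (1 + x²/(4t)) (t + 1)`.
  have hE : |x| * Real.exp (-x ^ 2 / (4 * t)) ≤ t + 1 := by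
    have h1 : x ^ 2 / (4 * t) + 1 ≤ Real.exp (x ^ 2 / (4 * t)) := Real.add_one_le_exp _
    have h2 : |x| ≤ (x ^ 2 / (4 * t) + 1) * (t + 1) := by
      have h3 : |x| ≤ x ^ 2 / 4 + 1 := by nlinarith [sq_nonneg (|x| / 2 - 1), sq_abs x]
      have h4 : x ^ 2 / (4 * t) * t = x ^ 2 / 4 := by field_simp
      have h5 : 0 ≤ x ^ 2 / (4 * t) := by positivity
      nlinarith
    rw [neg_div, Real.exp_neg, ← div_eq_mul_inv, div_le_iff₀ (Real.exp_pos _)]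
    calc _ ≤ _ := h2
      _ ≤ _ := by rw [mul_comm]; gcongr
  have h2 : (Real.sqrt (4 * Real.pi * t))⁻¹ ≤ (Real.sqrt (4 * Real.pi * δ))⁻¹ := by
    gcongr
  rw [dipole_eq ht, abs_mul, abs_neg, abs_div, abs_of_nonneg (heatKernel_nonneg x t),
    abs_of_pos (by positivity : 0 < 2 * t), heatKernel]
  calc |x| / (2 * t) * ((Real.sqrt (4 * Real.pi * t))⁻¹ * Real.exp (-x ^ 2 / (4 * t)))
      = (|x| * Real.exp (-x ^ 2 / (4 * t))) / (2 * t) * (Real.sqrt (4 * Real.pi * t))⁻¹ := by ring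
    _ ≤ (t + 1) / (2 * t) * (Real.sqrt (4 * Real.pi * δ))⁻¹ := by gcongr
    _ ≤ _ := by
      gcongr
      have : (t + 1) / (2 * t) = 1 / 2 + 1 / (2 * t) := by field_simp
      rw [this]
      gcongr
      · norm_num
      · linarith

/-! ### The Gaussian Taylor remainder -/

/-- Second-order Taylor estimate in `b` for the odd function `e^{-(a-b)²} - e^{-(a+b)²}`. The
second derivative is `ψ(a-b) - ψ(a+b)` with `ψ(z) = (4z²-2)e^{-z²}`, so the Lipschitz bound for
`ψ` produces the extra factor `a`. -/
lemma abs_gaussian_sub_le {a b : ℝ} (ha : 0 ≤ a) (hb : 0 ≤ b) :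
    |Real.exp (-(a - b) ^ 2) - Real.exp (-(a + b) ^ 2) - 4 * a * b * Real.exp (-a ^ 2)|
      ≤ 24 * a * b ^ 2 := by
  set ψ : ℝ → ℝ := fun z => (4 * z ^ 2 - 2) * Real.exp (-z ^ 2) with hψ
  have hexp (z : ℝ) : HasDerivAt (fun z : ℝ => Real.exp (-z ^ 2))
      (-2 * z * Real.exp (-z ^ 2)) z := by
    convert! ((hasDerivAt_pow 2 z).neg).exp using 1
    simp only [Pi.neg_apply]; ring
  have hψd (z : ℝ) : HasDerivAt ψ ((12 * z - 8 * z ^ 3) * Real.exp (-z ^ 2)) z := by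
    convert! (((hasDerivAt_pow 2 z).const_mul 4).sub_const 2).mul (hexp z) using 1
    ring
  have hψb (z : ℝ) : ‖(12 * z - 8 * z ^ 3) * Real.exp (-z ^ 2)‖ ≤ 12 := by
    rw [norm_mul, Real.norm_eq_abs, Real.norm_eq_abs, abs_of_pos (Real.exp_pos _), Real.exp_neg,
      ← div_eq_mul_inv, div_le_iff₀ (Real.exp_pos _)]
    have h1 := Real.quadratic_le_exp_of_nonneg (sq_nonneg z)
    have h2 : |12 * z - 8 * z ^ 3| ≤ 12 * (1 + z ^ 2 + (z ^ 2) ^ 2 / 2) := by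
      rw [abs_le]
      constructor
      · nlinarith [sq_nonneg (z - 1), sq_nonneg (z + 1), mul_nonneg (sq_nonneg z)
          (sq_nonneg (z - 1)), mul_nonneg (sq_nonneg z) (sq_nonneg (z + 1)), sq_nonneg (z ^ 2)]
      · nlinarith [sq_nonneg (z - 1), sq_nonneg (z + 1), mul_nonneg (sq_nonneg z)
          (sq_nonneg (z - 1)), mul_nonneg (sq_nonneg z) (sq_nonneg (z + 1)), sq_nonneg (z ^ 2)]
    linarith
  have hψL (y z : ℝ) : ‖ψ z - ψ y‖ ≤ 12 * ‖z - y‖ :=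
    Convex.norm_image_sub_le_of_norm_hasDerivWithin_le
      (fun x _ => (hψd x).hasDerivWithinAt) (fun x _ => hψb x) convex_univ (mem_univ y)
      (mem_univ z)
  have hm (z : ℝ) : HasDerivAt (fun z : ℝ => a - z) (-1) z := (hasDerivAt_id z).const_sub a
  have hp (z : ℝ) : HasDerivAt (fun z : ℝ => a + z) 1 z := (hasDerivAt_id z).const_add a
  set F' : ℝ → ℝ := fun z => 2 * (a - z) * Real.exp (-(a - z) ^ 2)
    + 2 * (a + z) * Real.exp (-(a + z) ^ 2) - 4 * a * Real.exp (-a ^ 2) with hF'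
  have hFd (z : ℝ) : HasDerivAt (fun b : ℝ => Real.exp (-(a - b) ^ 2) - Real.exp (-(a + b) ^ 2)
      - 4 * a * b * Real.exp (-a ^ 2)) (F' z) z := by
    convert! (((hexp (a - z)).comp z (hm z)).sub ((hexp (a + z)).comp z (hp z))).sub
      (((hasDerivAt_id z).const_mul (4 * a)).mul_const (Real.exp (-a ^ 2))) using 1
    simp only [hF']; ring
  have hF'd (z : ℝ) : HasDerivAt F' (ψ (a - z) - ψ (a + z)) z := by
    have h := (((((hm z).const_mul 2).mul ((hexp (a - z)).comp z (hm z))).add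
      (((hp z).const_mul 2).mul ((hexp (a + z)).comp z (hp z))))).sub_const
      (4 * a * Real.exp (-a ^ 2))
    convert! h using 1
    simp only [hψ, Function.comp_apply]; ring
  -- `ψ` is even, so its arguments may be taken at distance `2a` instead of `2z`.
  have hF'' (z : ℝ) : ‖ψ (a - z) - ψ (a + z)‖ ≤ 24 * a := by
    have he : ψ (a - z) = ψ (z - a) := by simp only [hψ, ← neg_sub a z, neg_sq]
    rw [he]
    refine (hψL _ _).trans (le_of_eq ?_)
    rw [show z - a - (a + z) = -(2 * a) by ring, norm_neg, Real.norm_eq_abs,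
      abs_of_nonneg (by positivity)]
    ring
  have h1 (z : ℝ) (hz : z ∈ Icc 0 b) : ‖F' z‖ ≤ 24 * a * b := by
    have h := Convex.norm_image_sub_le_of_norm_hasDerivWithin_le
      (fun x _ => (hF'd x).hasDerivWithinAt) (fun x _ => hF'' x) convex_univ (mem_univ 0)
      (mem_univ z)
    have h0 : F' 0 = 0 := by simp only [hF']; ring_nf
    rw [h0, sub_zero, sub_zero, Real.norm_eq_abs z, abs_of_nonneg hz.1] at h
    refine h.trans ?_
    gcongr
    exact hz.2
  have h := Convex.norm_image_sub_le_of_norm_hasDerivWithin_le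
      (fun x _ => (hFd x).hasDerivWithinAt) h1 (convex_Icc 0 b) (left_mem_Icc.2 hb)
      (right_mem_Icc.2 hb)
  simp only [sub_zero, add_zero, sub_self, mul_zero, zero_mul, Real.norm_eq_abs,
    abs_of_nonneg hb] at h
  exact h.trans (le_of_eq (by ring))

/-! ### The Dirichlet heat kernel of the half line -/

/-- The heat kernel of the half line with Dirichlet condition at `0`, obtained from the Gauss
kernel by odd reflection in the source point `y`. -/
noncomputable def dirichletKernel (x y t : ℝ) : ℝ := heatKernel (x - y) t - heatKernel (x + y) t

lemma dirichletKernel_zero (x t : ℝ) : dirichletKernel x 0 t = 0 := by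
  simp [dirichletKernel]

lemma hasDerivAt_dirichletKernel {t : ℝ} (ht : 0 < t) (x y : ℝ) :
    HasDerivAt (fun y => dirichletKernel x y t) (-dipole (x - y) t - dipole (x + y) t) y := by
  have h1 := (hasDerivAt_heatKernel_space ht (x - y)).comp y ((hasDerivAt_id y).const_sub x)
  have h2 := (hasDerivAt_heatKernel_space ht (x + y)).comp y ((hasDerivAt_id y).const_add x)
  convert! h1.sub h2 using 1
  rw [dipole_eq ht, dipole_eq ht]; ring

lemma hasDerivAt_dirichletKernel_deriv {t : ℝ} (ht : 0 < t) (x y : ℝ) :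
    HasDerivAt (fun y => -dipole (x - y) t - dipole (x + y) t)
      (heatKernelXX (x - y) t - heatKernelXX (x + y) t) y := by
  have h1 := (hasDerivAt_dipole ht (x - y)).comp y ((hasDerivAt_id y).const_sub x)
  have h2 := (hasDerivAt_dipole ht (x + y)).comp y ((hasDerivAt_id y).const_add x)
  convert! h1.neg.sub h2 using 1
  ring

lemma hasDerivAt_dirichletKernel_time {t : ℝ} (ht : 0 < t) (x y : ℝ) :
    HasDerivAt (fun s => dirichletKernel x y s)
      (heatKernelXX (x - y) t - heatKernelXX (x + y) t) t :=
  (hasDerivAt_heatKernel_time ht (x - y)).sub (hasDerivAt_heatKernel_time ht (x + y))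

lemma abs_dirichletKernel_le {δ t : ℝ} (hδ : 0 < δ) (h : δ ≤ t) (x y : ℝ) :
    |dirichletKernel x y t| ≤ (Real.sqrt (4 * Real.pi * δ))⁻¹ := by
  have h1 := heatKernel_le hδ h (x - y)
  have h2 := heatKernel_le hδ h (x + y)
  have h3 := heatKernel_nonneg (x - y) t
  have h4 := heatKernel_nonneg (x + y) t
  rw [dirichletKernel, abs_le]
  constructor <;> linarith

lemma continuous_dirichletKernel {t : ℝ} (ht : 0 < t) (x : ℝ) :
    Continuous fun y => dirichletKernel x y t :=
  continuous_iff_continuousAt.2 fun y => (hasDerivAt_dirichletKernel ht x y).continuousAt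

/-- The Dirichlet kernel is its linear part `-2yD` in the source point up to `O(x y² t⁻²)`. -/
lemma abs_dirichletKernel_add_dipole_le {x y t : ℝ} (hx : 0 ≤ x) (hy : 0 ≤ y) (ht : 0 < t) :
    |dirichletKernel x y t + 2 * y * dipole x t| ≤ 3 * x * y ^ 2 / t ^ 2 := by
  set r := Real.sqrt t with hr
  have hr0 : 0 < r := Real.sqrt_pos.2 ht
  have hrt : r ^ 2 = t := Real.sq_sqrt ht.le
  have hG (z : ℝ) : heatKernel z t
      = (Real.sqrt (4 * Real.pi * t))⁻¹ * Real.exp (-(z / (2 * r)) ^ 2) := by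
    rw [heatKernel, div_pow, mul_pow, hrt]; ring_nf
  have h := abs_gaussian_sub_le (a := x / (2 * r)) (b := y / (2 * r)) (by positivity)
    (by positivity)
  have h2 : (Real.sqrt (4 * Real.pi * t))⁻¹ ≤ r⁻¹ := by
    have : t ≤ 4 * Real.pi * t := by nlinarith [Real.pi_gt_three]
    gcongr
    exact Real.sqrt_le_sqrt this
  have e : dirichletKernel x y t + 2 * y * dipole x t = (Real.sqrt (4 * Real.pi * t))⁻¹ *
      (Real.exp (-(x / (2 * r) - y / (2 * r)) ^ 2) - Real.exp (-(x / (2 * r) + y / (2 * r)) ^ 2)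
        - 4 * (x / (2 * r)) * (y / (2 * r)) * Real.exp (-(x / (2 * r)) ^ 2)) := by
    rw [dirichletKernel, dipole_eq ht, hG, hG, hG, sub_div, add_div, ← hrt]
    field_simp
    ring
  rw [e, abs_mul, abs_of_nonneg (by positivity)]
  calc _ ≤ r⁻¹ * (24 * (x / (2 * r)) * (y / (2 * r)) ^ 2) := by gcongr
    _ = _ := by rw [← hrt]; field_simp; ring

/-! ### Green's identity -/

/-- Green's identity for the heat operator on a rectangle away from the boundary, tested with a
function `ψ` vanishing together with `ψ_y` on the lateral sides. -/
lemma IsDirichletHeatSolution.green_identity {u₀ : ℝ → ℝ} {u : ℝ → ℝ → ℝ}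
    (hu : IsDirichletHeatSolution u₀ u) {a b s₁ s₂ : ℝ} (ha : 0 < a) (hab : a ≤ b)
    (hs₁ : 0 < s₁) (hs : s₁ ≤ s₂) {ψ ψy ψyy ψs : ℝ → ℝ → ℝ}
    (hy : ∀ s ∈ Icc s₁ s₂, ∀ y, HasDerivAt (fun y => ψ y s) (ψy y s) y)
    (hyy : ∀ s ∈ Icc s₁ s₂, ∀ y, HasDerivAt (fun y => ψy y s) (ψyy y s) y)
    (hψs : ∀ s ∈ Icc s₁ s₂, ∀ y, HasDerivAt (fun s => ψ y s) (ψs y s) s)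
    (cψ : ContinuousOn (fun p : ℝ × ℝ => ψ p.1 p.2) (univ ×ˢ Icc s₁ s₂))
    (cyy : ContinuousOn (fun p : ℝ × ℝ => ψyy p.1 p.2) (univ ×ˢ Icc s₁ s₂))
    (cs : ContinuousOn (fun p : ℝ × ℝ => ψs p.1 p.2) (univ ×ˢ Icc s₁ s₂))
    (hψa : ∀ s ∈ Icc s₁ s₂, ψ a s = 0 ∧ ψy a s = 0)
    (hψb : ∀ s ∈ Icc s₁ s₂, ψ b s = 0 ∧ ψy b s = 0) :
    (∫ y in a..b, u y s₂ * ψ y s₂) - (∫ y in a..b, u y s₁ * ψ y s₁)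
      = ∫ s in s₁..s₂, ∫ y in a..b, u y s * (ψyy y s + ψs y s) := by
  set ut : ℝ → ℝ → ℝ := fun y s => deriv (fun s => u y s) s with hut
  set ux : ℝ → ℝ → ℝ := fun y s => deriv (fun y => u y s) y with hux
  set uxx : ℝ → ℝ → ℝ := fun y s => deriv (deriv (fun y => u y s)) y with huxx
  have hsub : Icc a b ×ˢ Icc s₁ s₂ ⊆ Ioi (0 : ℝ) ×ˢ Ioi (0 : ℝ) :=
    prod_mono (fun y h => ha.trans_le h.1) (fun s h => hs₁.trans_le h.1)
  have hsub' : Icc a b ×ˢ Icc s₁ s₂ ⊆ (univ : Set ℝ) ×ˢ Icc s₁ s₂ :=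
    prod_mono (subset_univ _) subset_rfl
  have Cu : ContinuousOn (fun p : ℝ × ℝ => u p.1 p.2) (Icc a b ×ˢ Icc s₁ s₂) :=
    hu.continuousOn.mono (hsub.trans (prod_mono Ioi_subset_Ici_self subset_rfl))
  have Cut : ContinuousOn (fun p : ℝ × ℝ => ut p.1 p.2) (Icc a b ×ˢ Icc s₁ s₂) :=
    hu.continuousOn_time.mono hsub
  have Cux : ContinuousOn (fun p : ℝ × ℝ => ux p.1 p.2) (Icc a b ×ˢ Icc s₁ s₂) :=
    hu.continuousOn_space.mono hsub
  have Cuxx : ContinuousOn (fun p : ℝ × ℝ => uxx p.1 p.2) (Icc a b ×ˢ Icc s₁ s₂) :=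
    hu.continuousOn_space_space.mono hsub
  replace cψ := cψ.mono hsub'
  replace cyy := cyy.mono hsub'
  replace cs := cs.mono hsub'
  have secY {f : ℝ → ℝ → ℝ} (hf : ContinuousOn (fun p : ℝ × ℝ => f p.1 p.2)
      (Icc a b ×ˢ Icc s₁ s₂)) {s : ℝ} (h : s ∈ Icc s₁ s₂) :
      ContinuousOn (fun y => f y s) (uIcc a b) := by
    rw [uIcc_of_le hab]
    exact hf.comp (f := fun y => (y, s)) (by fun_prop) (fun y hy => ⟨hy, h⟩)
  have secS {f : ℝ → ℝ → ℝ} (hf : ContinuousOn (fun p : ℝ × ℝ => f p.1 p.2)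
      (Icc a b ×ˢ Icc s₁ s₂)) {y : ℝ} (h : y ∈ Icc a b) :
      ContinuousOn (fun s => f y s) (uIcc s₁ s₂) := by
    rw [uIcc_of_le hs]
    exact hf.comp (f := fun s => (y, s)) (by fun_prop) (fun s hs => ⟨h, hs⟩)
  have m1 : s₁ ∈ Icc s₁ s₂ := left_mem_Icc.2 hs
  have m2 : s₂ ∈ Icc s₁ s₂ := right_mem_Icc.2 hs
  have j {s : ℝ} (h : s ∈ Icc s₁ s₂) : IntervalIntegrable (fun y => u y s * ψ y s) volume a b :=
    ((secY Cu h).mul (secY cψ h)).intervalIntegrable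
  rw [← intervalIntegral.integral_sub (j m2) (j m1)]
  have hFTC : ∀ y ∈ uIcc a b, u y s₂ * ψ y s₂ - u y s₁ * ψ y s₁
      = ∫ s in s₁..s₂, (ut y s * ψ y s + u y s * ψs y s) := by
    intro y hyab
    rw [uIcc_of_le hab] at hyab
    refine (intervalIntegral.integral_deriv_mul_eq_sub (fun s h => ?_) (fun s h => ?_)
      (secS Cut hyab).intervalIntegrable (secS cs hyab).intervalIntegrable).symm
    · rw [uIcc_of_le hs] at h
      exact (hu.differentiableAt_time y (ha.trans_le hyab.1) s (hs₁.trans_le h.1)).hasDerivAt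
    · rw [uIcc_of_le hs] at h
      exact hψs s h y
  rw [intervalIntegral.integral_congr hFTC, intervalIntegral_intervalIntegral_swap]
  swap
  · rw [uIoc_of_le hab, uIoc_of_le hs]
    exact (((Cut.mul cψ).add (Cu.mul cs)).integrableOn_compact
      (isCompact_Icc.prod isCompact_Icc)).mono_set
      (prod_mono Ioc_subset_Icc_self Ioc_subset_Icc_self)
  refine intervalIntegral.integral_congr fun s hss => ?_
  rw [uIcc_of_le hs] at hss
  have hs0 : 0 < s := hs₁.trans_le hss.1
  have hpos : ∀ y ∈ uIcc a b, 0 < y := fun y h => by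
    rw [uIcc_of_le hab] at h; exact ha.trans_le h.1
  have cψy : ContinuousOn (fun y => ψy y s) (uIcc a b) :=
    fun y _ => (hyy s hss y).continuousAt.continuousWithinAt
  have e0 : ∀ y ∈ uIcc a b, ut y s = uxx y s := fun y h => hu.equation y (hpos y h) s hs0
  have e1 := intervalIntegral.integral_deriv_mul_eq_sub (u := fun y => ux y s)
    (v := fun y => ψ y s) (u' := fun y => uxx y s) (v' := fun y => ψy y s) (a := a) (b := b)
    (fun y h => (hu.differentiableAt_deriv_space y (hpos y h) s hs0).hasDerivAt)
    (fun y _ => hy s hss y) (secY Cuxx hss).intervalIntegrable cψy.intervalIntegrable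
  have e2 := intervalIntegral.integral_deriv_mul_eq_sub (u := fun y => u y s)
    (v := fun y => ψy y s) (u' := fun y => ux y s) (v' := fun y => ψyy y s) (a := a) (b := b)
    (fun y h => (hu.differentiableAt_space y (hpos y h) s hs0).hasDerivAt)
    (fun y _ => hyy s hss y) (secY Cux hss).intervalIntegrable (secY cyy hss).intervalIntegrable
  rw [(hψa s hss).1, (hψb s hss).1] at e1
  rw [(hψa s hss).2, (hψb s hss).2] at e2
  have i1 : IntervalIntegrable (fun y => uxx y s * ψ y s + ux y s * ψy y s) volume a b :=
    (((secY Cuxx hss).mul (secY cψ hss)).add ((secY Cux hss).mul cψy)).intervalIntegrable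
  have i2 : IntervalIntegrable (fun y => ux y s * ψy y s + u y s * ψyy y s) volume a b :=
    (((secY Cux hss).mul cψy).add ((secY Cu hss).mul (secY cyy hss))).intervalIntegrable
  have i3 : IntervalIntegrable (fun y => u y s * (ψyy y s + ψs y s)) volume a b :=
    ((secY Cu hss).mul ((secY cyy hss).add (secY cs hss))).intervalIntegrable
  have e3 : (∫ y in a..b, (ut y s * ψ y s + u y s * ψs y s)) =
      ∫ y in a..b, ((uxx y s * ψ y s + ux y s * ψy y s)
        - (ux y s * ψy y s + u y s * ψyy y s) + u y s * (ψyy y s + ψs y s)) := by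
    refine intervalIntegral.integral_congr fun y h => ?_
    rw [e0 y h]; ring
  rw [e3, intervalIntegral.integral_add (i1.sub i2) i3, intervalIntegral.integral_sub i1 i2, e1, e2]
  ring

/-! ### Smooth cutoffs -/

lemma deriv_smoothTransition_eq_zero {z : ℝ} (hz : z < 0 ∨ 1 < z) :
    deriv Real.smoothTransition z = 0 := by
  rcases hz with hz | hz
  · have : Real.smoothTransition =ᶠ[𝓝 z] fun _ => 0 := by
      filter_upwards [Iio_mem_nhds hz] with w hw
      exact Real.smoothTransition.zero_of_nonpos (le_of_lt hw)
    rw [this.deriv_eq, deriv_const]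
  · have : Real.smoothTransition =ᶠ[𝓝 z] fun _ => 1 := by
      filter_upwards [Ioi_mem_nhds hz] with w hw
      exact Real.smoothTransition.one_of_one_le (le_of_lt hw)
    rw [this.deriv_eq, deriv_const]

lemma deriv_deriv_smoothTransition_eq_zero {z : ℝ} (hz : z < 0 ∨ 1 < z) :
    deriv (deriv Real.smoothTransition) z = 0 := by
  have : deriv Real.smoothTransition =ᶠ[𝓝 z] fun _ => 0 := by
    rcases hz with hz | hz
    · filter_upwards [Iio_mem_nhds hz] with w hw
      exact deriv_smoothTransition_eq_zero (Or.inl hw)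
    · filter_upwards [Ioi_mem_nhds hz] with w hw
      exact deriv_smoothTransition_eq_zero (Or.inr hw)
  rw [this.deriv_eq, deriv_const]

lemma contDiff_deriv_smoothTransition : ContDiff ℝ 1 (deriv Real.smoothTransition) :=
  (contDiff_succ_iff_deriv (n := 1)).1 Real.smoothTransition.contDiff |>.2.2

lemma continuous_deriv_deriv_smoothTransition :
    Continuous (deriv (deriv Real.smoothTransition)) :=
  contDiff_deriv_smoothTransition.continuous_deriv le_rfl

lemma exists_bound_smoothTransition : ∃ C : ℝ, 0 ≤ C ∧ ∀ z,
    |deriv Real.smoothTransition z| ≤ C ∧ |deriv (deriv Real.smoothTransition) z| ≤ C := by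
  obtain ⟨C₁, h₁⟩ := (isCompact_Icc (a := (0 : ℝ)) (b := 1)).exists_bound_of_continuousOn
    contDiff_deriv_smoothTransition.continuous.continuousOn
  obtain ⟨C₂, h₂⟩ := (isCompact_Icc (a := (0 : ℝ)) (b := 1)).exists_bound_of_continuousOn
    continuous_deriv_deriv_smoothTransition.continuousOn
  refine ⟨max 0 (max C₁ C₂), le_max_left _ _, fun z => ?_⟩
  by_cases hz : z ∈ Icc (0 : ℝ) 1
  · exact ⟨(h₁ z hz).trans ((le_max_left _ _).trans (le_max_right _ _)),
      (h₂ z hz).trans ((le_max_right _ _).trans (le_max_right _ _))⟩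
  · have hz' : z < 0 ∨ 1 < z := by
      by_contra! h
      exact hz ⟨h.1, h.2⟩
    simp [deriv_smoothTransition_eq_zero hz', deriv_deriv_smoothTransition_eq_zero hz']

/-- A smooth ramp which is `0` on `(-∞, r]` and `1` on `[2r, ∞)`. -/
noncomputable def ramp (r y : ℝ) : ℝ := Real.smoothTransition (y / r - 1)

/-- The derivative of `ramp r`. -/
noncomputable def rampD (r y : ℝ) : ℝ := deriv Real.smoothTransition (y / r - 1) / r

/-- The second derivative of `ramp r`. -/
noncomputable def rampDD (r y : ℝ) : ℝ := deriv (deriv Real.smoothTransition) (y / r - 1) / r ^ 2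

lemma hasDerivAt_ramp (r y : ℝ) : HasDerivAt (ramp r) (rampD r y) y := by
  have h := ((Real.smoothTransition.contDiff (n := 1)).differentiable (by simp)
    (y / r - 1)).hasDerivAt.comp y (((hasDerivAt_id y).div_const r).sub_const 1)
  convert! h using 1
  simp [rampD, div_eq_mul_inv]

lemma hasDerivAt_rampD (r y : ℝ) : HasDerivAt (rampD r) (rampDD r y) y := by
  have h := ((contDiff_deriv_smoothTransition.differentiable (by simp)
    (y / r - 1)).hasDerivAt.comp y (((hasDerivAt_id y).div_const r).sub_const 1)).div_const r
  convert! h using 1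
  simp only [rampDD, div_eq_mul_inv]; ring

lemma continuous_ramp (r : ℝ) : Continuous (ramp r) :=
  continuous_iff_continuousAt.2 fun y => (hasDerivAt_ramp r y).continuousAt

lemma continuous_rampD (r : ℝ) : Continuous (rampD r) :=
  continuous_iff_continuousAt.2 fun y => (hasDerivAt_rampD r y).continuousAt

lemma continuous_rampDD (r : ℝ) : Continuous (rampDD r) :=
  (continuous_deriv_deriv_smoothTransition.comp (by fun_prop)).div_const _

lemma ramp_eq_zero {r y : ℝ} (hr : 0 < r) (h : y ≤ r) : ramp r y = 0 :=
  Real.smoothTransition.zero_of_nonpos (by rw [sub_nonpos, div_le_one hr]; exact h)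

lemma ramp_eq_one {r y : ℝ} (hr : 0 < r) (h : 2 * r ≤ y) : ramp r y = 1 :=
  Real.smoothTransition.one_of_one_le (by rw [le_sub_iff_add_le, le_div_iff₀ hr]; linarith)

lemma abs_ramp_sub_ramp_le (r R y : ℝ) : |ramp r y - ramp R y| ≤ 1 := by
  have h1 := Real.smoothTransition.nonneg (y / r - 1)
  have h2 := Real.smoothTransition.le_one (y / r - 1)
  have h3 := Real.smoothTransition.nonneg (y / R - 1)
  have h4 := Real.smoothTransition.le_one (y / R - 1)
  rw [ramp, ramp, abs_le]
  constructor <;> linarith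

lemma outside_of_notMem_Icc {r y : ℝ} (hr : 0 < r) (h : y ∉ Icc r (2 * r)) :
    y / r - 1 < 0 ∨ 1 < y / r - 1 := by
  rw [mem_Icc, not_and_or, not_le, not_le] at h
  rcases h with h | h
  · left; rw [sub_neg, div_lt_one hr]; exact h
  · right; rw [lt_sub_iff_add_lt, lt_div_iff₀ hr]; linarith

lemma rampD_eq_zero {r y : ℝ} (hr : 0 < r) (h : y ∉ Icc r (2 * r)) : rampD r y = 0 := by
  rw [rampD, deriv_smoothTransition_eq_zero (outside_of_notMem_Icc hr h), zero_div]

lemma rampDD_eq_zero {r y : ℝ} (hr : 0 < r) (h : y ∉ Icc r (2 * r)) : rampDD r y = 0 := by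
  rw [rampDD, deriv_deriv_smoothTransition_eq_zero (outside_of_notMem_Icc hr h), zero_div]

/-- The commutator of `∂_y²` with multiplication by `ramp r`, applied to a function of value `q`
and slope `p` that vanishes linearly at the origin, is `O(1/r)` and lives on `[r, 2r]`. -/
lemma abs_commutator_le {C K r y p q : ℝ} (hK : 0 ≤ K)
    (hS : ∀ z, |deriv Real.smoothTransition z| ≤ C ∧
      |deriv (deriv Real.smoothTransition) z| ≤ C)
    (hr : 0 < r) (hp : |p| ≤ K) (hq : |q| ≤ K * |y|) :
    |2 * p * rampD r y + q * rampDD r y|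
      ≤ (Icc r (2 * r)).indicator (fun _ => 4 * K * C / r) y := by
  by_cases h : y ∈ Icc r (2 * r)
  · rw [indicator_of_mem h]
    have h1 : |rampD r y| ≤ C / r := by
      rw [rampD, abs_div, abs_of_pos hr]
      gcongr
      exact (hS _).1
    have h2 : |rampDD r y| ≤ C / r ^ 2 := by
      rw [rampDD, abs_div, abs_of_pos (pow_pos hr 2)]
      gcongr
      exact (hS _).2
    have h3 : |q| ≤ K * (2 * r) := by
      refine hq.trans ?_
      rw [abs_of_nonneg (hr.le.trans h.1)]
      gcongr
      exact h.2
    calc _ ≤ |2 * p * rampD r y| + |q * rampDD r y| := abs_add_le _ _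
      _ = 2 * |p| * |rampD r y| + |q| * |rampDD r y| := by
        rw [abs_mul, abs_mul, abs_mul, abs_two]
      _ ≤ 2 * K * (C / r) + K * (2 * r) * (C / r ^ 2) := by gcongr
      _ = _ := by field_simp; ring
  · rw [indicator_of_notMem h, rampD_eq_zero hr h, rampDD_eq_zero hr h]
    simp

/-! ### Consequences of the definition of a solution -/

namespace IsDirichletHeatSolution

variable {u₀ : ℝ → ℝ} {u : ℝ → ℝ → ℝ}

lemma exists_abs_le_near_boundary (hu : IsDirichletHeatSolution u₀ u) {s₁ s₂ e : ℝ}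
    (hs₁ : 0 < s₁) (he : 0 < e) :
    ∃ ρ > 0, ∀ y ∈ Icc 0 ρ, ∀ s ∈ Icc s₁ s₂, |u y s| ≤ e := by
  have hc : ContinuousOn (fun p : ℝ × ℝ => u p.1 p.2) (Icc 0 1 ×ˢ Icc s₁ s₂) :=
    hu.continuousOn.mono (prod_mono Icc_subset_Ici_self fun s h => hs₁.trans_le h.1)
  obtain ⟨δ, hδ, h⟩ := Metric.uniformContinuousOn_iff.1
    ((isCompact_Icc.prod isCompact_Icc).uniformContinuousOn_of_continuous hc) e he
  refine ⟨min 1 (δ / 2), by positivity, fun y hy s hs => ?_⟩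
  have h1 := h (y, s) ⟨⟨hy.1, hy.2.trans (min_le_left _ _)⟩, hs⟩ (0, s)
    ⟨⟨le_rfl, zero_le_one⟩, hs⟩ ?_
  · simp only [Real.dist_eq, hu.boundary s (hs₁.trans_le hs.1), sub_zero] at h1
    exact h1.le
  · have := hy.2.trans (min_le_right _ _)
    rw [Prod.dist_eq, dist_self, Real.dist_eq, sub_zero, abs_of_nonneg hy.1]
    exact max_lt (by linarith) hδ

lemma exists_integral_abs_le (hu : IsDirichletHeatSolution u₀ u) (T : ℝ) :
    ∃ N, 0 ≤ N ∧ ∀ s ∈ Icc 0 T, ∫ y in Ioi 0, |u y s| ≤ N := by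
  have hc : ContinuousOn (fun s => ∫ y in Ioi 0, |u y s|) (Icc 0 T) := by
    intro s hs
    refine ContinuousWithinAt.mono ?_ Icc_subset_Ici_self
    rw [ContinuousWithinAt, tendsto_iff_dist_tendsto_zero]
    refine squeeze_zero' (Eventually.of_forall fun _ => dist_nonneg) ?_
      (hu.continuous_L1 s hs.1)
    filter_upwards [self_mem_nhdsWithin] with r hr
    rw [Real.dist_eq, ← integral_sub (hu.integrable r hr).abs (hu.integrable s hs.1).abs]
    refine (abs_integral_le_integral_abs).trans ?_
    exact integral_mono ((hu.integrable r hr).abs.sub (hu.integrable s hs.1).abs).abs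
      ((hu.integrable r hr).sub (hu.integrable s hs.1)).abs
      fun y => abs_abs_sub_abs_le _ _
  obtain ⟨N, hN⟩ := isCompact_Icc.exists_bound_of_continuousOn hc
  refine ⟨max 0 N, le_max_left _ _, fun s hs => ?_⟩
  exact (le_abs_self _).trans ((hN s hs).trans (le_max_right _ _))

end IsDirichletHeatSolution

/-! ### Duality with backward caloric functions -/

/-- `φ` solves the backward heat equation `φ_s = -φ_yy` for `s ∈ [s₁, s₂]` and vanishes at
`y = 0`; `φy`, `φyy` are its space derivatives, and `φ`, `φy` are bounded by `B`, `K`. -/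
structure IsBackwardCaloric (φ φy φyy : ℝ → ℝ → ℝ) (s₁ s₂ B K : ℝ) : Prop where
  deriv_space : ∀ s ∈ Icc s₁ s₂, ∀ y, HasDerivAt (fun y => φ y s) (φy y s) y
  deriv_space_space : ∀ s ∈ Icc s₁ s₂, ∀ y, HasDerivAt (fun y => φy y s) (φyy y s) y
  deriv_time : ∀ s ∈ Icc s₁ s₂, ∀ y, HasDerivAt (fun s => φ y s) (-φyy y s) s
  continuousOn : ContinuousOn (fun p : ℝ × ℝ => φ p.1 p.2) (univ ×ˢ Icc s₁ s₂)
  continuousOn_space : ContinuousOn (fun p : ℝ × ℝ => φy p.1 p.2) (univ ×ˢ Icc s₁ s₂)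
  continuousOn_space_space : ContinuousOn (fun p : ℝ × ℝ => φyy p.1 p.2) (univ ×ˢ Icc s₁ s₂)
  boundary : ∀ s ∈ Icc s₁ s₂, φ 0 s = 0
  bound : ∀ s ∈ Icc s₁ s₂, ∀ y, |φ y s| ≤ B
  bound_space : ∀ s ∈ Icc s₁ s₂, ∀ y, |φy y s| ≤ K

lemma IsBackwardCaloric.abs_le {φ φy φyy : ℝ → ℝ → ℝ} {s₁ s₂ B K : ℝ}
    (hφ : IsBackwardCaloric φ φy φyy s₁ s₂ B K) {s : ℝ} (hs : s ∈ Icc s₁ s₂) (y : ℝ) :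
    |φ y s| ≤ K * |y| := by
  have h := Convex.norm_image_sub_le_of_norm_hasDerivWithin_le
    (fun x _ => (hφ.deriv_space s hs x).hasDerivWithinAt) (fun x _ => hφ.bound_space s hs x)
    convex_univ (mem_univ 0) (mem_univ y)
  simpa [hφ.boundary s hs] using h

namespace IsDirichletHeatSolution

variable {u₀ : ℝ → ℝ} {u : ℝ → ℝ → ℝ}

/-- The pairing of `u` with a backward caloric function, cut off near `0` and near `∞`, is almost
conserved. Each transition layer of the cutoff carries an error `O(1/r) ∫_{[r,2r]} |u|`: at `r = ε`
the factor `1/ε` is compensated by the length of the layer and `u` is small there, at `r = R` the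
`L¹` norm of `u` is enough. -/
lemma abs_cutoff_pairing_sub_le (hu : IsDirichletHeatSolution u₀ u)
    {φ φy φyy : ℝ → ℝ → ℝ} {s₁ s₂ B K C ε R m N : ℝ}
    (hφ : IsBackwardCaloric φ φy φyy s₁ s₂ B K) (hs₁ : 0 < s₁) (hs : s₁ ≤ s₂)
    (hC : 0 ≤ C) (hS : ∀ z, |deriv Real.smoothTransition z| ≤ C ∧
      |deriv (deriv Real.smoothTransition) z| ≤ C)
    (hε : 0 < ε) (hεR : 2 * ε ≤ R)
    (hm : ∀ y ∈ Icc 0 (2 * ε), ∀ s ∈ Icc s₁ s₂, |u y s| ≤ m)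
    (hN : ∀ s ∈ Icc 0 s₂, ∫ y in Ioi 0, |u y s| ≤ N) :
    |(∫ y in Ioi 0, u y s₂ * (φ y s₂ * (ramp ε y - ramp R y)))
      - ∫ y in Ioi 0, u y s₁ * (φ y s₁ * (ramp ε y - ramp R y))|
      ≤ 4 * K * C * (m + N / R) * (s₂ - s₁) := by
  have hR : 0 < R := by linarith
  have hK : 0 ≤ K := (abs_nonneg _).trans (hφ.bound_space s₁ (left_mem_Icc.2 hs) 0)
  -- The endpoints are chosen strictly outside the transition layers `[ε, 2ε]` and `[R, 2R]`, so
  -- that the cutoff vanishes there together with its derivative.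
  set a := ε / 2 with ha
  set b := 3 * R with hb
  have ha0 : 0 < a := by positivity
  have hab : a ≤ b := by linarith
  set η : ℝ → ℝ := fun y => ramp ε y - ramp R y with hη
  set ηD : ℝ → ℝ := fun y => rampD ε y - rampD R y with hηD
  set ηDD : ℝ → ℝ := fun y => rampDD ε y - rampDD R y with hηDD
  have dη (y : ℝ) : HasDerivAt η (ηD y) y := (hasDerivAt_ramp ε y).sub (hasDerivAt_ramp R y)
  have dηD (y : ℝ) : HasDerivAt ηD (ηDD y) y := (hasDerivAt_rampD ε y).sub (hasDerivAt_rampD R y)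
  have cη : Continuous η := (continuous_ramp ε).sub (continuous_ramp R)
  have cηD : Continuous ηD := (continuous_rampD ε).sub (continuous_rampD R)
  have cηDD : Continuous ηDD := (continuous_rampDD ε).sub (continuous_rampDD R)
  have ηa {y : ℝ} (h : y ≤ a) : η y = 0 := by
    simp only [hη]
    rw [ramp_eq_zero hε (by linarith), ramp_eq_zero hR (by linarith), sub_zero]
  have ηb {y : ℝ} (h : b ≤ y) : η y = 0 := by
    simp only [hη]
    rw [ramp_eq_one hε (by linarith), ramp_eq_one hR (by linarith), sub_self]
  have ηDa : ηD a = 0 := by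
    simp only [hηD]
    rw [rampD_eq_zero hε fun h => by linarith [h.1], rampD_eq_zero hR fun h => by linarith [h.1],
      sub_zero]
  have ηDb : ηD b = 0 := by
    simp only [hηD]
    rw [rampD_eq_zero hε fun h => by linarith [h.2], rampD_eq_zero hR fun h => by linarith [h.2],
      sub_zero]
  have toInterval (s : ℝ) : (∫ y in Ioi 0, u y s * (φ y s * η y))
      = ∫ y in a..b, u y s * (φ y s * η y) := by
    rw [intervalIntegral.integral_of_le hab]
    refine setIntegral_eq_of_subset_of_forall_sdiff_eq_zero measurableSet_Ioi
      (fun y h => ha0.trans h.1) fun y hy => ?_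
    rcases not_and_or.1 hy.2 with h | h
    · rw [ηa (not_lt.1 h), mul_zero, mul_zero]
    · rw [ηb (not_le.1 h).le, mul_zero, mul_zero]
  have c1 {f : ℝ → ℝ} (hf : Continuous f) :
      ContinuousOn (fun p : ℝ × ℝ => f p.1) (univ ×ˢ Icc s₁ s₂) :=
    (hf.comp continuous_fst).continuousOn
  have green := hu.green_identity ha0 hab hs₁ hs
    (ψ := fun y s => φ y s * η y) (ψy := fun y s => φy y s * η y + φ y s * ηD y)
    (ψyy := fun y s => (φyy y s * η y + φy y s * ηD y) + (φy y s * ηD y + φ y s * ηDD y))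
    (ψs := fun y s => -φyy y s * η y)
    (fun s h y => (hφ.deriv_space s h y).mul (dη y))
    (fun s h y => ((hφ.deriv_space_space s h y).mul (dη y)).add
      ((hφ.deriv_space s h y).mul (dηD y)))
    (fun s h y => (hφ.deriv_time s h y).mul_const _)
    (hφ.continuousOn.mul (c1 cη))
    (((hφ.continuousOn_space_space.mul (c1 cη)).add (hφ.continuousOn_space.mul (c1 cηD))).add
      ((hφ.continuousOn_space.mul (c1 cηD)).add (hφ.continuousOn.mul (c1 cηDD))))
    (hφ.continuousOn_space_space.neg.mul (c1 cη))
    (fun s h => by simp [ηa le_rfl, ηDa]) (fun s h => by simp [ηb le_rfl, ηDb])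
  rw [toInterval, toInterval, green, ← Real.norm_eq_abs]
  refine (intervalIntegral.norm_integral_le_of_norm_le_const
    (C := 4 * K * C * (m + N / R)) fun s hss => ?_).trans_eq
    (by rw [abs_of_nonneg (sub_nonneg.2 hs)])
  rw [uIoc_of_le hs] at hss
  have hss' : s ∈ Icc s₁ s₂ := Ioc_subset_Icc_self hss
  have hs0 : 0 ≤ s := hs₁.le.trans hss'.1
  -- The two transition layers of the cutoff contribute separately.
  have hint : IntegrableOn (fun y => |u y s|) (Ioi 0) := (hu.integrable s hs0).abs
  set g₁ : ℝ → ℝ := (Icc ε (2 * ε)).indicator fun _ => m * (4 * K * C / ε) with hg₁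
  set g₂ : ℝ → ℝ := fun y => |u y s| * (4 * K * C / R) with hg₂
  have hg₁i : IntegrableOn g₁ (Ioi 0) :=
    ((integrable_indicator_iff measurableSet_Icc).2
      (integrableOn_const (by simp))).integrableOn
  have hg₂i : IntegrableOn g₂ (Ioi 0) := hint.mul_const _
  have hpt : ∀ y ∈ Ioi (0 : ℝ), ‖u y s * ((φyy y s * η y + φy y s * ηD y)
      + (φy y s * ηD y + φ y s * ηDD y) + -φyy y s * η y)‖ ≤ g₁ y + g₂ y := by
    intro y hy
    have hy : 0 < y := hy
    have hq := hφ.abs_le hss' y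
    have hp := hφ.bound_space s hss' y
    have k1 := abs_commutator_le hK hS hε hp hq
    have k2 := abs_commutator_le hK hS hR hp hq
    have k2' : (Icc R (2 * R)).indicator (fun _ => 4 * K * C / R) y ≤ 4 * K * C / R :=
      indicator_le_self' (fun _ _ => by positivity) y
    have k1' : |u y s| * (Icc ε (2 * ε)).indicator (fun _ => 4 * K * C / ε) y ≤ g₁ y := by
      by_cases h : y ∈ Icc ε (2 * ε)
      · rw [hg₁, indicator_of_mem h, indicator_of_mem h]
        have := hm y ⟨hy.le, h.2⟩ s hss'
        gcongr
      · rw [hg₁, indicator_of_notMem h, indicator_of_notMem h, mul_zero]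
    rw [norm_mul, Real.norm_eq_abs, Real.norm_eq_abs,
      show (φyy y s * η y + φy y s * ηD y) + (φy y s * ηD y + φ y s * ηDD y) + -φyy y s * η y
        = (2 * φy y s * rampD ε y + φ y s * rampDD ε y)
          - (2 * φy y s * rampD R y + φ y s * rampDD R y) by simp only [hηD, hηDD]; ring]
    calc _ ≤ |u y s| * ((Icc ε (2 * ε)).indicator (fun _ => 4 * K * C / ε) y + 4 * K * C / R) := by
          gcongr
          exact (abs_sub _ _).trans (add_le_add k1 (k2.trans k2'))
      _ ≤ _ := by
          rw [mul_add]
          exact add_le_add k1' le_rfl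
  rw [intervalIntegral.integral_of_le hab]
  have hsub : Ioc a b ⊆ Ioi 0 := fun y h => ha0.trans h.1
  calc _ ≤ ∫ y in Ioc a b, (g₁ y + g₂ y) :=
        norm_integral_le_of_norm_le ((hg₁i.add hg₂i).mono_set hsub)
          ((ae_restrict_iff' measurableSet_Ioc).2 (Eventually.of_forall fun y hy => hpt y (hsub hy)))
    _ ≤ ∫ y in Ioi 0, (g₁ y + g₂ y) :=
        setIntegral_mono_set (hg₁i.add hg₂i)
          ((ae_restrict_iff' measurableSet_Ioi).2 (Eventually.of_forall fun y hy =>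
            (norm_nonneg _).trans (hpt y hy))) hsub.eventuallyLE
    _ = (∫ y in Ioi 0, g₁ y) + ∫ y in Ioi 0, g₂ y := integral_add hg₁i hg₂i
    _ ≤ 4 * K * C * m + N * (4 * K * C / R) := by
        refine add_le_add ?_ ?_
        · have hsub₁ : Icc ε (2 * ε) ⊆ Ioi 0 := fun y h => hε.trans_le h.1
          rw [hg₁, setIntegral_indicator measurableSet_Icc,
            inter_eq_self_of_subset_right hsub₁]
          simp only [integral_const, smul_eq_mul, measureReal_restrict_apply_univ]
          rw [Real.volume_real_Icc_of_le (by linarith)]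
          refine le_of_eq ?_
          field_simp
          ring
        · rw [hg₂, integral_mul_const]
          gcongr
          exact hN s ⟨hs0, hss'.2⟩
    _ = _ := by field_simp

/-- The pairing with a bounded backward caloric function is conserved at positive times. Since the
test function vanishes at `0`, no information on `u_x` at the boundary and no growth condition on
`u` at infinity is needed. -/
lemma pairing_eq (hu : IsDirichletHeatSolution u₀ u) {φ φy φyy : ℝ → ℝ → ℝ} {s₁ s₂ B K : ℝ}
    (hφ : IsBackwardCaloric φ φy φyy s₁ s₂ B K) (hs₁ : 0 < s₁) (hs : s₁ ≤ s₂) :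
    ∫ y in Ioi 0, u y s₂ * φ y s₂ = ∫ y in Ioi 0, u y s₁ * φ y s₁ := by
  have m1 : s₁ ∈ Icc s₁ s₂ := left_mem_Icc.2 hs
  have m2 : s₂ ∈ Icc s₁ s₂ := right_mem_Icc.2 hs
  have hK : 0 ≤ K := (abs_nonneg _).trans (hφ.bound_space s₁ m1 0)
  have hB : 0 ≤ B := (abs_nonneg _).trans (hφ.bound s₁ m1 0)
  obtain ⟨C, hC, hS⟩ := exists_bound_smoothTransition
  obtain ⟨N, hN0, hN⟩ := hu.exists_integral_abs_le s₂
  set ε : ℕ → ℝ := fun n => 1 / ((n : ℝ) + 1) with hε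
  set R : ℕ → ℝ := fun n => (n : ℝ) + 2 with hR
  have tε : Tendsto ε atTop (𝓝 0) := tendsto_one_div_add_atTop_nhds_zero_nat
  have tR : Tendsto R atTop atTop :=
    tendsto_atTop_add_const_right _ _ tendsto_natCast_atTop_atTop
  have hε0 (n : ℕ) : 0 < ε n := by positivity
  have hR0 (n : ℕ) : 0 < R n := by positivity
  have hεR (n : ℕ) : 2 * ε n ≤ R n := by
    have : ε n ≤ 1 := by
      simp only [hε]
      rw [div_le_one (by positivity)]
      linarith [(Nat.cast_nonneg n : (0 : ℝ) ≤ n)]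
    have : 2 ≤ R n := by
      simp only [hR]
      linarith [(Nat.cast_nonneg n : (0 : ℝ) ≤ n)]
    linarith
  have lim {s : ℝ} (h : s ∈ Icc s₁ s₂) :
      Tendsto (fun n => ∫ y in Ioi 0, u y s * (φ y s * (ramp (ε n) y - ramp (R n) y))) atTop
        (𝓝 (∫ y in Ioi 0, u y s * φ y s)) := by
    have hi := hu.integrable s (hs₁.le.trans h.1)
    have cφ : Continuous fun y => φ y s :=
      continuous_iff_continuousAt.2 fun y => (hφ.deriv_space s h y).continuousAt
    refine tendsto_integral_of_dominated_convergence (fun y => |u y s| * B) (fun n => ?_)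
      (hi.abs.mul_const B) (fun n => Eventually.of_forall fun y => ?_) ?_
    · exact hi.aestronglyMeasurable.mul (cφ.mul
        ((continuous_ramp _).sub (continuous_ramp _))).aestronglyMeasurable
    · rw [norm_mul, norm_mul, Real.norm_eq_abs, Real.norm_eq_abs, Real.norm_eq_abs]
      calc _ ≤ |u y s| * (B * 1) := by
            gcongr
            · exact hφ.bound s h y
            · exact abs_ramp_sub_ramp_le _ _ _
        _ = _ := by rw [mul_one]
    · refine (ae_restrict_iff' measurableSet_Ioi).2 (Eventually.of_forall fun y hy => ?_)
      have hy : 0 < y := hy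
      refine tendsto_const_nhds.congr' ?_
      filter_upwards [tε.eventually (gt_mem_nhds (half_pos hy)), tR.eventually_ge_atTop y]
        with n h1 h2
      rw [ramp_eq_one (hε0 n) (by linarith), ramp_eq_zero (hR0 n) h2, sub_zero, mul_one]
  have hlim := ((lim m2).sub (lim m1)).abs
  rw [← sub_eq_zero, ← abs_eq_zero]
  refine le_antisymm (le_of_forall_pos_le_add fun e he => ?_) (abs_nonneg _)
  rw [zero_add]
  set A := 4 * K * C * (s₂ - s₁) with hA
  have hA0 : 0 ≤ A := by
    have := sub_nonneg.2 hs
    positivity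
  set m := e / (2 * (A + 1)) with hm
  have hm0 : 0 < m := by positivity
  obtain ⟨ρ, hρ, hbd⟩ := hu.exists_abs_le_near_boundary (s₂ := s₂) hs₁ hm0
  refine le_of_tendsto hlim ?_
  have tN : Tendsto (fun n => N / R n) atTop (𝓝 0) := tendsto_const_nhds.div_atTop tR
  filter_upwards [tε.eventually (gt_mem_nhds (half_pos hρ)), tN.eventually (gt_mem_nhds hm0)]
    with n h1 h2
  refine (hu.abs_cutoff_pairing_sub_le hφ hs₁ hs hC hS (hε0 n) (hεR n)
    (fun y hy s h => hbd y ⟨hy.1, hy.2.trans (by linarith)⟩ s h) hN).trans ?_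
  calc 4 * K * C * (m + N / R n) * (s₂ - s₁) = A * (m + N / R n) := by rw [hA]; ring
    _ ≤ (A + 1) * (m + m) := by
      gcongr
      linarith
    _ = e := by rw [hm]; field_simp; norm_num

end IsDirichletHeatSolution

/-! ### The representation by the Dirichlet kernel -/

lemma isBackwardCaloric_dirichletKernel (x : ℝ) {s₁ s₂ τ : ℝ} (h : s₂ < τ) :
    IsBackwardCaloric (fun y s => dirichletKernel x y (τ - s))
      (fun y s => -dipole (x - y) (τ - s) - dipole (x + y) (τ - s))
      (fun y s => heatKernelXX (x - y) (τ - s) - heatKernelXX (x + y) (τ - s)) s₁ s₂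
      (Real.sqrt (4 * Real.pi * (τ - s₂)))⁻¹
      (2 * ((1 + 1 / (τ - s₂)) * (Real.sqrt (4 * Real.pi * (τ - s₂)))⁻¹)) := by
  have hδ : 0 < τ - s₂ := sub_pos.2 h
  have hle {s : ℝ} (hs : s ∈ Icc s₁ s₂) : τ - s₂ ≤ τ - s := by linarith [hs.2]
  have hpos {s : ℝ} (hs : s ∈ Icc s₁ s₂) : 0 < τ - s := hδ.trans_le (hle hs)
  have cm {f : ℝ → ℝ → ℝ} (hf : ContinuousOn (fun p : ℝ × ℝ => f p.1 p.2) (univ ×ˢ Ioi 0)) :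
      ContinuousOn (fun p : ℝ × ℝ => f (x - p.1) (τ - p.2)) (univ ×ˢ Icc s₁ s₂) :=
    hf.comp (f := fun p : ℝ × ℝ => (x - p.1, τ - p.2)) (by fun_prop)
      fun p hp => ⟨mem_univ _, hpos hp.2⟩
  have cp {f : ℝ → ℝ → ℝ} (hf : ContinuousOn (fun p : ℝ × ℝ => f p.1 p.2) (univ ×ˢ Ioi 0)) :
      ContinuousOn (fun p : ℝ × ℝ => f (x + p.1) (τ - p.2)) (univ ×ˢ Icc s₁ s₂) :=
    hf.comp (f := fun p : ℝ × ℝ => (x + p.1, τ - p.2)) (by fun_prop)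
      fun p hp => ⟨mem_univ _, hpos hp.2⟩
  refine ⟨fun s hs y => hasDerivAt_dirichletKernel (hpos hs) x y,
    fun s hs y => hasDerivAt_dirichletKernel_deriv (hpos hs) x y, fun s hs y => ?_,
    (cm continuousOn_heatKernel).sub (cp continuousOn_heatKernel),
    (cm continuousOn_dipole).neg.sub (cp continuousOn_dipole),
    (cm continuousOn_heatKernelXX).sub (cp continuousOn_heatKernelXX),
    fun s _ => dirichletKernel_zero x _, fun s hs y => abs_dirichletKernel_le hδ (hle hs) x y,
    fun s hs y => ?_⟩
  · convert! (hasDerivAt_dirichletKernel_time (hpos hs) x y).comp s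
      ((hasDerivAt_id s).const_sub τ) using 1
    ring
  · have h1 := abs_dipole_le hδ (hle hs) (x - y)
    have h2 := abs_dipole_le hδ (hle hs) (x + y)
    have h3 := abs_sub (-dipole (x - y) (τ - s)) (dipole (x + y) (τ - s))
    rw [abs_neg] at h3
    linarith

lemma integrableOn_mul_dirichletKernel {f : ℝ → ℝ} (hf : IntegrableOn f (Ioi 0)) (x : ℝ) {t : ℝ}
    (ht : 0 < t) : IntegrableOn (fun y => f y * dirichletKernel x y t) (Ioi 0) :=
  Integrable.mul_bdd (c := (Real.sqrt (4 * Real.pi * t))⁻¹) hf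
    (continuous_dirichletKernel ht x).aestronglyMeasurable
    (Eventually.of_forall fun y => abs_dirichletKernel_le ht le_rfl x y)

lemma integral_heatKernel_one : ∫ z, heatKernel z 1 = 1 := by
  have h (z : ℝ) : heatKernel z 1
      = (Real.sqrt (4 * Real.pi))⁻¹ * Real.exp (-(1 / 4) * z ^ 2) := by
    rw [heatKernel, mul_one, mul_one]; ring_nf
  simp_rw [h]
  rw [integral_const_mul, integral_gaussian, show Real.pi / (1 / 4) = 4 * Real.pi by ring]
  exact inv_mul_cancel₀ (Real.sqrt_pos.2 (by positivity)).ne'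

/-- The Gauss kernel is an approximate identity at points of continuity of an integrable
function. -/
lemma tendsto_integral_heatKernel_mul {g : ℝ → ℝ} {x : ℝ} (hg : Integrable g)
    (hx : ContinuousAt g x) :
    Tendsto (fun δ => ∫ y, g y * heatKernel (x - y) δ) (𝓝[>] 0) (𝓝 (g x)) := by
  have hdecay : Tendsto (fun z : ℝ => ‖z‖ ^ Module.finrank ℝ ℝ * heatKernel z 1)
      (Bornology.cobounded ℝ) (𝓝 0) := by
    have h1 : Tendsto (fun z : ℝ => 8 / |z|) (Bornology.cobounded ℝ) (𝓝 0) :=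
      tendsto_const_nhds.div_atTop tendsto_norm_cobounded_atTop
    refine squeeze_zero (fun z => mul_nonneg (by positivity) (heatKernel_nonneg z 1)) (fun z => ?_)
      h1
    rw [Module.finrank_self, pow_one, Real.norm_eq_abs]
    rcases eq_or_ne z 0 with rfl | hz
    · simp
    have hz0 : 0 < |z| := abs_pos.2 hz
    have h2 : (Real.sqrt (4 * Real.pi * 1))⁻¹ ≤ 1 := by
      refine inv_le_one_of_one_le₀ (Real.one_le_sqrt.2 ?_)
      linarith [Real.pi_gt_three]
    have h3 : Real.exp (-z ^ 2 / (4 * 1)) ≤ 4 / z ^ 2 := by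
      have := Real.add_one_le_exp (z ^ 2 / 4)
      rw [mul_one, neg_div, Real.exp_neg, inv_le_comm₀ (Real.exp_pos _) (by positivity), inv_div]
      linarith
    calc |z| * heatKernel z 1 ≤ |z| * (1 * (4 / z ^ 2)) := by
          unfold heatKernel; gcongr
      _ = 4 / |z| := by rw [← sq_abs]; field_simp
      _ ≤ 8 / |z| := by gcongr; norm_num
  have h := tendsto_integral_comp_smul_smul_of_integrable' (μ := volume)
    (fun z => heatKernel_nonneg z 1) integral_heatKernel_one hdecay hg hx
  have hc : Tendsto (fun δ : ℝ => (Real.sqrt δ)⁻¹) (𝓝[>] 0) atTop := by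
    refine Tendsto.inv_tendsto_nhdsGT_zero ?_
    refine tendsto_nhdsWithin_iff.2 ⟨?_, ?_⟩
    · have : Tendsto Real.sqrt (𝓝 0) (𝓝 (Real.sqrt 0)) := Real.continuous_sqrt.tendsto 0
      rw [Real.sqrt_zero] at this
      exact this.mono_left nhdsWithin_le_nhds
    · filter_upwards [self_mem_nhdsWithin] with δ hδ using Real.sqrt_pos.2 hδ
  refine (h.comp hc).congr' ?_
  filter_upwards [self_mem_nhdsWithin] with δ hδ
  have hδ : 0 < δ := hδ
  refine integral_congr_ae (Eventually.of_forall fun y => ?_)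
  have hs := Real.sqrt_pos.2 hδ
  have hs2 := Real.sq_sqrt hδ.le
  simp only [Module.finrank_self, pow_one, smul_eq_mul, heatKernel, mul_one]
  rw [Real.sqrt_mul (by positivity) δ, mul_pow, inv_pow, hs2, mul_inv,
    show -(δ⁻¹ * (x - y) ^ 2) / 4 = -(x - y) ^ 2 / (4 * δ) by field_simp]
  ring

/-- The Dirichlet kernel is an approximate identity at interior points of continuity. -/
lemma tendsto_integral_dirichletKernel {f : ℝ → ℝ} {x : ℝ} (hx : 0 < x)
    (hf : IntegrableOn f (Ioi 0)) (hc : ContinuousAt f x) :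
    Tendsto (fun δ => ∫ y in Ioi 0, f y * dirichletKernel x y δ) (𝓝[>] 0) (𝓝 (f x)) := by
  set g : ℝ → ℝ := (Ioi 0).indicator f with hg
  have gi : Integrable g := (integrable_indicator_iff measurableSet_Ioi).2 hf
  have g1 : g =ᶠ[𝓝 x] f := by
    filter_upwards [Ioi_mem_nhds hx] with y hy using indicator_of_mem hy f
  have g2 : g =ᶠ[𝓝 (-x)] fun _ => 0 := by
    filter_upwards [Iio_mem_nhds (neg_neg_of_pos hx)] with y hy
    exact indicator_of_notMem (not_lt.2 (le_of_lt hy)) f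
  have t1 := tendsto_integral_heatKernel_mul gi (hc.congr g1.symm)
  have t2 := tendsto_integral_heatKernel_mul gi (continuousAt_const.congr g2.symm)
  have t := t1.sub t2
  rw [g1.eq_of_nhds, g2.eq_of_nhds, sub_zero] at t
  refine t.congr' ?_
  filter_upwards [self_mem_nhdsWithin] with δ hδ
  have hδ : 0 < δ := hδ
  have int (z : ℝ) : Integrable (fun y => g y * heatKernel (z - y) δ) := by
    refine gi.mul_bdd (c := (Real.sqrt (4 * Real.pi * δ))⁻¹) ?_ (Eventually.of_forall fun y => ?_)
    · refine Continuous.aestronglyMeasurable ?_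
      unfold heatKernel
      fun_prop
    · rw [Real.norm_eq_abs, abs_of_nonneg (heatKernel_nonneg _ _)]
      exact heatKernel_le hδ le_rfl _
  rw [← integral_sub (int x) (int (-x)), ← integral_indicator measurableSet_Ioi]
  refine integral_congr_ae (Eventually.of_forall fun y => ?_)
  simp only [hg, indicator]
  split_ifs
  · rw [dirichletKernel, show -x - y = -(x + y) by ring, heatKernel_neg]; ring
  · simp

namespace IsDirichletHeatSolution

variable {u₀ : ℝ → ℝ} {u : ℝ → ℝ → ℝ}

/-- The pairing with a Dirichlet kernel converges to its initial value, by `L¹` continuity. -/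
lemma tendsto_pairing_zero (hu : IsDirichletHeatSolution u₀ u) (x : ℝ) {T δ : ℝ} (hT : 0 < T)
    (hδ : 0 < δ) :
    Tendsto (fun s => ∫ y in Ioi 0, u y s * dirichletKernel x y (T + δ - s)) (𝓝[>] 0)
      (𝓝 (∫ y in Ioi 0, u y 0 * dirichletKernel x y (T + δ))) := by
  set B := (Real.sqrt (4 * Real.pi * δ))⁻¹ with hB
  have hev : ∀ᶠ s in 𝓝[>] (0 : ℝ), 0 < s ∧ s < T :=
    Ioo_mem_nhdsGT hT
  have h0 := hu.integrable 0 le_rfl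
  have t1 : Tendsto (fun s => ∫ y in Ioi 0, u y 0 * dirichletKernel x y (T + δ - s)) (𝓝[>] 0)
      (𝓝 (∫ y in Ioi 0, u y 0 * dirichletKernel x y (T + δ))) := by
    refine tendsto_integral_filter_of_dominated_convergence (fun y => |u y 0| * B) ?_ ?_
      (h0.abs.mul_const B) ?_
    · filter_upwards [hev] with s hs
      exact (integrableOn_mul_dirichletKernel h0 x (by linarith)).aestronglyMeasurable
    · filter_upwards [hev] with s hs
      refine Eventually.of_forall fun y => ?_
      rw [norm_mul, Real.norm_eq_abs, Real.norm_eq_abs]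
      gcongr
      exact abs_dirichletKernel_le hδ (by linarith) x y
    · refine Eventually.of_forall fun y => ?_
      refine tendsto_const_nhds.mul (Tendsto.mono_left ?_ nhdsWithin_le_nhds)
      have hc := (hasDerivAt_dirichletKernel_time (t := T + δ - 0) (by linarith) x y).continuousAt
      have hl : Tendsto (fun s => T + δ - s) (𝓝 0) (𝓝 (T + δ - 0)) :=
        (by fun_prop : Continuous fun s => T + δ - s).tendsto 0
      simpa [Function.comp_def] using hc.tendsto.comp hl
  have t2 : Tendsto (fun s => ∫ y in Ioi 0, (u y s - u y 0) * dirichletKernel x y (T + δ - s))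
      (𝓝[>] 0) (𝓝 0) := by
    have hL := ((hu.continuous_L1 0 le_rfl).mono_left
      (nhdsWithin_mono 0 Ioi_subset_Ici_self)).mul_const B
    rw [zero_mul] at hL
    refine squeeze_zero_norm' ?_ hL
    filter_upwards [hev] with s hs
    rw [← integral_mul_const]
    refine norm_integral_le_of_norm_le
      (((hu.integrable s hs.1.le).sub h0).abs.mul_const B) (Eventually.of_forall fun y => ?_)
    rw [norm_mul, Real.norm_eq_abs, Real.norm_eq_abs]
    gcongr
    exact abs_dirichletKernel_le hδ (by linarith) x y
  have t := t2.add t1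
  rw [zero_add] at t
  refine t.congr' ?_
  filter_upwards [hev] with s hs
  have hd : IntegrableOn (fun y => u y s - u y 0) (Ioi 0) := (hu.integrable s hs.1.le).sub h0
  rw [← integral_add (integrableOn_mul_dirichletKernel hd x (by linarith))
    (integrableOn_mul_dirichletKernel h0 x (by linarith))]
  refine integral_congr_ae (Eventually.of_forall fun y => ?_)
  ring

/-- Propagating `u(·,T)` for a further time `δ` by the Dirichlet
kernel gives the propagation of `u₀` for the time `T + δ`. -/
lemma integral_mul_dirichletKernel_eq (hu : IsDirichletHeatSolution u₀ u) (x : ℝ) {T δ : ℝ}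
    (hT : 0 < T) (hδ : 0 < δ) :
    ∫ y in Ioi 0, u y T * dirichletKernel x y δ
      = ∫ y in Ioi 0, u₀ y * dirichletKernel x y (T + δ) := by
  have h1 : ∫ y in Ioi 0, u₀ y * dirichletKernel x y (T + δ)
      = ∫ y in Ioi 0, u y 0 * dirichletKernel x y (T + δ) := by
    refine integral_congr_ae ?_
    filter_upwards [hu.initial] with y hy
    rw [hy]
  rw [h1]
  refine tendsto_nhds_unique (tendsto_const_nhds.congr' ?_) (hu.tendsto_pairing_zero x hT hδ)
  filter_upwards [Ioo_mem_nhdsGT hT] with s hs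
  have := hu.pairing_eq (isBackwardCaloric_dirichletKernel x (s₁ := s) (τ := T + δ)
    (by linarith : T < T + δ)) hs.1 hs.2.le
  simpa using this

/-! ### The decay estimate -/

/-- A quantitative form of the convergence to the dipole, with the explicit rate `x t⁻²`. -/
lemma abs_add_dipole_le (hu : IsDirichletHeatSolution u₀ u)
    (hu₀ : IntegrableOn (fun x => (1 + x + x ^ 2) * u₀ x) (Ioi 0)) {x t : ℝ} (hx : 0 ≤ x)
    (ht : 0 < t) :
    |u x t + 2 * firstMoment u₀ * dipole x t|
      ≤ 3 * x / t ^ 2 * ∫ y in Ioi 0, (1 + y + y ^ 2) * |u₀ y| := by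
  have hw : IntegrableOn (fun y => (1 + y + y ^ 2) * |u₀ y|) (Ioi 0) := by
    refine hu₀.abs.congr ?_
    filter_upwards [ae_restrict_mem measurableSet_Ioi] with y hy
    have hy : 0 < y := hy
    rw [abs_mul, abs_of_pos (by positivity : 0 < 1 + y + y ^ 2)]
  have h0 : IntegrableOn u₀ (Ioi 0) := (hu.integrable 0 le_rfl).congr hu.initial
  have h1 : IntegrableOn (fun y => u₀ y * y) (Ioi 0) := by
    refine Integrable.mono' hw (h0.aestronglyMeasurable.mul
      continuous_id.aestronglyMeasurable) ?_
    filter_upwards [ae_restrict_mem measurableSet_Ioi] with y hy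
    have hy : 0 < y := hy
    rw [norm_mul, Real.norm_eq_abs, Real.norm_eq_abs, abs_of_pos hy, mul_comm]
    gcongr
    nlinarith
  rcases hx.eq_or_lt with rfl | hx0
  · simp [hu.boundary t ht, dipole_eq ht]
  have hcu : ContinuousAt (fun y => u y t) x :=
    (hu.differentiableAt_space x hx0 t ht).continuousAt
  have lim1 := tendsto_integral_dirichletKernel hx0 (hu.integrable t ht.le) hcu
  have lt : Tendsto (fun δ : ℝ => t + δ) (𝓝[>] 0) (𝓝 t) := by
    have : Tendsto (fun δ : ℝ => t + δ) (𝓝 0) (𝓝 (t + 0)) :=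
      (continuous_const.add continuous_id).tendsto 0
    rw [add_zero] at this
    exact this.mono_left nhdsWithin_le_nhds
  have hcd : ContinuousAt (fun s => dipole x s) t := by
    refine ((continuousOn_dipole.continuousAt (x := (x, t))
      (prod_mem_nhds univ_mem (Ioi_mem_nhds ht))).comp (f := fun s => (x, s))
      (by fun_prop))
  have lim2 := (lim1.add (((hcd.tendsto.comp lt)).const_mul (2 * firstMoment u₀))).abs
  have lim3 : Tendsto (fun δ : ℝ => 3 * x / (t + δ) ^ 2 *
      ∫ y in Ioi 0, (1 + y + y ^ 2) * |u₀ y|) (𝓝[>] 0)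
      (𝓝 (3 * x / t ^ 2 * ∫ y in Ioi 0, (1 + y + y ^ 2) * |u₀ y|)) :=
    (tendsto_const_nhds.div (lt.pow 2) (by positivity)).mul_const _
  refine le_of_tendsto_of_tendsto lim2 lim3 ?_
  filter_upwards [self_mem_nhdsWithin] with δ hδ
  have hδ : 0 < δ := hδ
  have htδ : 0 < t + δ := by positivity
  simp only [Function.comp_apply]
  rw [hu.integral_mul_dirichletKernel_eq x ht hδ, firstMoment]
  have e : (∫ y in Ioi 0, u₀ y * dirichletKernel x y (t + δ))
      + 2 * (∫ y in Ioi 0, u₀ y * y) * dipole x (t + δ)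
      = ∫ y in Ioi 0, u₀ y * (dirichletKernel x y (t + δ) + 2 * y * dipole x (t + δ)) := by
    rw [show 2 * (∫ y in Ioi 0, u₀ y * y) * dipole x (t + δ)
      = ∫ y in Ioi 0, u₀ y * y * (2 * dipole x (t + δ)) by rw [integral_mul_const]; ring,
      ← integral_add (integrableOn_mul_dirichletKernel h0 x htδ) (h1.mul_const _)]
    refine integral_congr_ae (Eventually.of_forall fun y => ?_)
    ring
  rw [e, ← integral_const_mul, ← Real.norm_eq_abs]
  refine norm_integral_le_of_norm_le (hw.const_mul _) ?_
  filter_upwards [ae_restrict_mem measurableSet_Ioi] with y hy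
  have hy : 0 < y := hy
  rw [norm_mul, Real.norm_eq_abs, Real.norm_eq_abs]
  calc _ ≤ |u₀ y| * (3 * x * y ^ 2 / (t + δ) ^ 2) := by
        gcongr
        exact abs_dirichletKernel_add_dipole_le hx hy.le htδ
    _ = 3 * x / (t + δ) ^ 2 * (y ^ 2 * |u₀ y|) := by ring
    _ ≤ _ := by
        gcongr
        linarith

end IsDirichletHeatSolution

theorem theorem1p1 (u₀ : ℝ → ℝ) (u : ℝ → ℝ → ℝ)
    (hu₀ : IntegrableOn (fun x => (1 + x + x ^ 2) * u₀ x) (Ioi (0 : ℝ)))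
    (hu : IsDirichletHeatSolution u₀ u) :
    TendstoUniformlyOn
      (fun (t x : ℝ) => t ^ (3 / 2 : ℝ) / (x + 1) *
        |u x t + 2 * firstMoment u₀ * dipole x t|)
      (fun _ => (0 : ℝ)) atTop (Ici 0) := by
  set A := ∫ y in Ioi 0, (1 + y + y ^ 2) * |u₀ y| with hA
  have hA0 : 0 ≤ A := setIntegral_nonneg measurableSet_Ioi fun y hy => by
    have hy : 0 < y := hy
    positivity
  rw [Metric.tendstoUniformlyOn_iff]
  intro e he
  have lim : Tendsto (fun t : ℝ => 3 * A * t ^ (-(1 / 2 : ℝ))) atTop (𝓝 (3 * A * 0)) :=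
    (tendsto_rpow_neg_atTop (by norm_num)).const_mul _
  rw [mul_zero] at lim
  filter_upwards [lim.eventually (gt_mem_nhds he), eventually_gt_atTop 0] with t h1 ht x hx
  have hx : 0 ≤ x := hx
  rw [dist_zero_left, Real.norm_eq_abs, abs_of_nonneg (by positivity)]
  refine lt_of_le_of_lt ?_ h1
  have hpow : t ^ (3 / 2 : ℝ) / t ^ 2 = t ^ (-(1 / 2 : ℝ)) := by
    rw [← Real.rpow_natCast t 2, ← Real.rpow_sub ht]
    norm_num
  calc _ ≤ t ^ (3 / 2 : ℝ) / (x + 1) * (3 * x / t ^ 2 * A) := by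
        gcongr
        exact hu.abs_add_dipole_le hu₀ hx ht
    _ = 3 * A * (t ^ (3 / 2 : ℝ) / t ^ 2) * (x / (x + 1)) := by ring
    _ ≤ 3 * A * (t ^ (3 / 2 : ℝ) / t ^ 2) * 1 := by
        gcongr
        rw [div_le_one (by positivity)]
        linarith
    _ = _ := by rw [mul_one, hpow]
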